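/- Let $dA(z)=\frac{dx\,dy}{\pi}$ be the normalized area measure on $\mathbb C$, let $\mathbb D(0,R)$ be the open disk of radius $R$ centred at $0$, and for an entire function $f$ and $R>0$ put $$\Psi_f(z,R)=\bigl(|f(z)|e^{-|z|^2}-1_{\mathbb D(0,R)}(z)\bigr)^2 ,\qquad z\in\mathbb C.$$ Define the planar discrepancy densities $$\rho_{\mathbb C}=\liminf_{R\to\infty}\ \inf_{f\in\operatorname{Pol}(\mathbb C)}\frac{\int_{\mathbb D(0,R)}\Psi_f(z,R)\,dA(z)}{\int_{\mathbb D(0,R)}dA(z)},\qquad \rho_{\mathbb C}^*=\liminf_{R\to\infty}\ \inf_{f\in\operatorname{Pol}(\mathbb C)}\frac{\int_{\mathbb C}\Psi_f(z,R)\,dA(z)}{\int_{\mathbb D(0,R)}dA(z)},$$ where $\operatorname{Pol}(\mathbb C)$ is the set of all complex polynomials. Let $\operatorname{Pol}_n(\mathbb C)$ be the set of complex polynomials of degree at most $n-1$ (including the zero polynomial), and let $n(R)=\lceil 2R^2\rceil$. Then $$\rho_{\mathbb C}=\liminf_{R\to\infty}\ \inf_{f\in\operatorname{Pol}_{n(R)}(\mathbb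 C)}\frac{\int_{\mathbb D(0,R)}\Psi_f(z,R)\,dA(z)}{\int_{\mathbb D(0,R)}dA(z)}\qquad\text{and}\qquad \rho_{\mathbb C}^*=\liminf_{R\to\infty}\ \inf_{f\in\operatorname{Pol}_{n(R)}(\mathbb C)}\frac{\int_{\mathbb C}\Psi_f(z,R)\,dA(z)}{\int_{\mathbb D(0,R)}dA(z)}.$$ -/

import Mathlib

open Filter MeasureTheory
open scoped ENNReal Polynomial

noncomputable section

namespace PlanarDiscrepancy

/-- The normalized area measure `dA = dx dy / π` on the complex plane. -/
def areaMeasure : Measure ℂ := ENNReal.ofReal (Real.pi⁻¹) • (volume : Measure ℂ)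

/-- The planar discrepancy function
`Ψ_f(z, R) = (|f(z)| e^{-|z|²} - 1_{D(0,R)}(z))²`, with `D(0,R)` the open disk. -/
def discrepancy (f : ℂ → ℂ) (R : ℝ) (z : ℂ) : ℝ :=
  (‖f z‖ * Real.exp (-‖z‖ ^ 2) - (Metric.ball (0 : ℂ) R).indicator (fun _ => (1 : ℝ)) z) ^ 2

/-- `(∫_{D(0,R)} Ψ_f(z, R) dA(z)) / (∫_{D(0,R)} dA(z))`. The integrand is nonnegative, so the
integral is taken with values in `[0, ∞]`. -/
def meanDiscrepancy (f : ℂ → ℂ) (R : ℝ) : ℝ≥0∞ :=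
  (∫⁻ z in Metric.ball (0 : ℂ) R, ENNReal.ofReal (discrepancy f R z) ∂areaMeasure) /
    ∫⁻ _z in Metric.ball (0 : ℂ) R, 1 ∂areaMeasure

/-- `(∫_ℂ Ψ_f(z, R) dA(z)) / (∫_{D(0,R)} dA(z))`. -/
def tightMeanDiscrepancy (f : ℂ → ℂ) (R : ℝ) : ℝ≥0∞ :=
  (∫⁻ z, ENNReal.ofReal (discrepancy f R z) ∂areaMeasure) /
    ∫⁻ _z in Metric.ball (0 : ℂ) R, 1 ∂areaMeasure

/-- The planar discrepancy density `ρ_ℂ`: the infimum is over all complex polynomials. -/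
def planarDensity : ℝ≥0∞ :=
  liminf (fun R : ℝ => ⨅ p : ℂ[X], meanDiscrepancy (fun z => p.eval z) R) atTop

/-- The tight planar discrepancy density `ρ_ℂ^*`. -/
def tightPlanarDensity : ℝ≥0∞ :=
  liminf (fun R : ℝ => ⨅ p : ℂ[X], tightMeanDiscrepancy (fun z => p.eval z) R) atTop

/-- `Pol_n(ℂ)`: the complex polynomials of degree at most `n - 1`, that is, of degree `< n`
(the zero polynomial included). -/
def polLT (n : ℕ) : Set ℂ[X] := {p | p.degree < n}

/-- `n(R) = ⌈2R²⌉`. -/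
def degreeBound (R : ℝ) : ℕ := ⌈2 * R ^ 2⌉₊

end PlanarDiscrepancy

end

/-! Fix a polynomial `p`, let `g` be its part of degree below `n = ⌈2R²⌉`, and let `c < 1` be close
to 1. Monomials are orthogonal for the weight e^{-2|z|²} on every rotation invariant set, so
truncation never increases Gaussian mass there (`gaussianMass_mono_coeff`). For k ≥ 2R² the density
|z|^{2k} e^{-2|z|²} increases on D(0,R), so the tail `p - g` has only a fraction (c² e^{1-c²})^n of
its D(0,R)-mass inside D(0,cR) (`gaussianMass_ball_le`). There `g` is close to `p` in L². Outside
D(0,cR) the indicator has mass at most (1-c²) times the disk area, so discrepancy is nearly Gaussian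
mass, which truncation does not increase. `discrepancy_truncation_le` combines the two regions; R →
∞, then c → 1, then t → 0 removes the error. -/

namespace PlanarDiscrepancy

/-! ### Orthogonality of monomials on rotation invariant sets -/

lemma measurePreserving_mul_areaMeasure {c : ℂ} (hc : ‖c‖ = 1) :
    MeasurePreserving (fun z : ℂ => c * z) areaMeasure areaMeasure := by
  have h2 : MeasurePreserving (fun z : ℂ => c * z) volume volume :=
    (rotation (⟨c, mem_sphere_zero_iff_norm.2 hc⟩ : Circle)).measurePreserving
  exact h2.smul_measure _

/-- Sets invariant under all rotations about the origin. -/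
def RotationInvariant (S : Set ℂ) : Prop :=
  ∀ c : ℂ, ‖c‖ = 1 → (fun z : ℂ => c * z) ⁻¹' S = S

lemma rotationInvariant_ball (r : ℝ) : RotationInvariant (Metric.ball 0 r) := by
  intro c hc
  ext z
  simp [hc]

lemma rotationInvariant_univ : RotationInvariant Set.univ := fun _ _ => rfl

lemma RotationInvariant.diff {S T : Set ℂ} (hS : RotationInvariant S) (hT : RotationInvariant T) :
    RotationInvariant (S \ T) := by
  intro c hc
  rw [Set.preimage_sdiff, hS c hc, hT c hc]

lemma integrable_norm_pow_mul_exp (k : ℕ) :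
    Integrable (fun z : ℂ => ‖z‖ ^ k * Real.exp (-‖z‖ ^ 2) ^ 2) areaMeasure := by
  refine Integrable.smul_measure ?_ ENNReal.ofReal_ne_top
  have h := Complex.integral_rpow_mul_exp_neg_mul_rpow (p := 2) (q := k) (b := 2)
    (by norm_num) (by have : (0 : ℝ) ≤ k := Nat.cast_nonneg k
                      linarith) (by norm_num)
  have h2 : (fun z : ℂ => ‖z‖ ^ k * Real.exp (-‖z‖ ^ 2) ^ 2) =
      fun z : ℂ => ‖z‖ ^ (k : ℝ) * Real.exp (-2 * ‖z‖ ^ (2 : ℝ)) := by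
    ext z
    rw [Real.rpow_natCast, Real.rpow_two, ← Real.exp_nat_mul]
    congr 2
    push_cast
    ring
  rw [h2]
  -- The Bochner integral of a non-integrable function is 0, so a nonzero value proves
  -- integrability.
  apply Integrable.of_integral_ne_zero
  rw [h]
  have : 0 < Real.Gamma (((k : ℝ) + 2) / 2) := Real.Gamma_pos_of_pos (by positivity)
  positivity

/-- `∫_S z^k conj(z)^l e^{-2|z|²} dA`. -/
noncomputable def monomialPairing (S : Set ℂ) (k l : ℕ) : ℂ :=
  ∫ z in S, z ^ k * (starRingEnd ℂ z) ^ l * ((Real.exp (-‖z‖ ^ 2) ^ 2 : ℝ) : ℂ) ∂areaMeasure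

lemma integrable_monomialPairing (k l : ℕ) :
    Integrable (fun z : ℂ => z ^ k * (starRingEnd ℂ z) ^ l *
      ((Real.exp (-‖z‖ ^ 2) ^ 2 : ℝ) : ℂ)) areaMeasure := by
  refine (integrable_norm_pow_mul_exp (k + l)).mono'
    (Continuous.aestronglyMeasurable (by fun_prop)) (.of_forall fun z => le_of_eq ?_)
  rw [norm_mul, norm_mul, norm_pow, norm_pow, RCLike.norm_conj, Complex.norm_real,
    Real.norm_of_nonneg (by positivity), pow_add]

lemma monomialPairing_of_ne {S : Set ℂ} (hS : RotationInvariant S) (hm : MeasurableSet S)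
    {k l : ℕ} (hkl : k ≠ l) : monomialPairing S k l = 0 := by
  have hkl' : ((k : ℂ) - l) ≠ 0 := sub_ne_zero.2 (by exact_mod_cast hkl)
  -- This angle makes c^{k-l} = -1, so rotating by `c` shows the integral equals its own negative.
  set t : ℝ := Real.pi / ((k : ℝ) - l) with ht
  set c : ℂ := Complex.exp (t * Complex.I) with hc
  have hc1 : ‖c‖ = 1 := Complex.norm_exp_ofReal_mul_I t
  have hcc : c ^ k * (starRingEnd ℂ c) ^ l = -1 := by
    rw [hc, ← Complex.exp_conj, ← Complex.exp_nat_mul, ← Complex.exp_nat_mul, ← Complex.exp_add,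
      ← Complex.exp_pi_mul_I]
    congr 1
    simp only [map_mul, Complex.conj_ofReal, Complex.conj_I, ht]
    push_cast
    field_simp
    ring
  have hmp : MeasurePreserving (fun z : ℂ => c * z) (areaMeasure.restrict S)
      (areaMeasure.restrict S) := by
    have := (measurePreserving_mul_areaMeasure hc1).restrict_preimage hm
    rwa [hS c hc1] at this
  have hemb : MeasurableEmbedding (fun z : ℂ => c * z) :=
    (Homeomorph.mulLeft₀ c (by rw [← norm_ne_zero_iff, hc1]; simp)).measurableEmbedding
  have h := hmp.integral_comp hemb (fun z : ℂ => z ^ k * (starRingEnd ℂ z) ^ l *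
    ((Real.exp (-‖z‖ ^ 2) ^ 2 : ℝ) : ℂ))
  have h2 : ∀ z : ℂ, (c * z) ^ k * (starRingEnd ℂ (c * z)) ^ l *
      ((Real.exp (-‖c * z‖ ^ 2) ^ 2 : ℝ) : ℂ) =
      -(z ^ k * (starRingEnd ℂ z) ^ l * ((Real.exp (-‖z‖ ^ 2) ^ 2 : ℝ) : ℂ)) := by
    intro z
    rw [norm_mul, hc1, one_mul, map_mul, mul_pow, mul_pow]
    linear_combination z ^ k * (starRingEnd ℂ z) ^ l *
      ((Real.exp (-‖z‖ ^ 2) ^ 2 : ℝ) : ℂ) * hcc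
  simp_rw [h2] at h
  rw [integral_neg] at h
  exact neg_eq_self.1 h

/-- `∫_S |p|² e^{-2|z|²} dA`. -/
noncomputable def gaussianMass (p : ℂ[X]) (S : Set ℂ) : ℝ≥0∞ :=
  ∫⁻ z in S, ENNReal.ofReal ((‖p.eval z‖ * Real.exp (-‖z‖ ^ 2)) ^ 2) ∂areaMeasure

lemma sq_norm_eval_mul_exp (p : ℂ[X]) {N : ℕ} (hN : p.natDegree < N) (z : ℂ) :
    (((‖p.eval z‖ * Real.exp (-‖z‖ ^ 2)) ^ 2 : ℝ) : ℂ) =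
      ∑ k ∈ Finset.range N, ∑ l ∈ Finset.range N, p.coeff k * starRingEnd ℂ (p.coeff l) *
        (z ^ k * (starRingEnd ℂ z) ^ l * ((Real.exp (-‖z‖ ^ 2) ^ 2 : ℝ) : ℂ)) := by
  rw [mul_pow, Complex.ofReal_mul, Complex.ofReal_pow ‖_‖, ← Complex.mul_conj',
    Polynomial.eval_eq_sum_range' hN, map_sum, Finset.sum_mul_sum, Finset.sum_mul]
  refine Finset.sum_congr rfl fun k _ => ?_
  rw [Finset.sum_mul]
  refine Finset.sum_congr rfl fun l _ => ?_
  rw [map_mul, map_pow]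
  ring

lemma integrable_sq_norm_eval_mul_exp (p : ℂ[X]) :
    Integrable (fun z : ℂ => (‖p.eval z‖ * Real.exp (-‖z‖ ^ 2)) ^ 2) areaMeasure := by
  have h : Integrable (fun z : ℂ => (((‖p.eval z‖ * Real.exp (-‖z‖ ^ 2)) ^ 2 : ℝ) : ℂ))
      areaMeasure := by
    simp_rw [sq_norm_eval_mul_exp p (Nat.lt_succ_self _)]
    exact integrable_finsetSum _ fun k _ => integrable_finsetSum _ fun l _ =>
      (integrable_monomialPairing k l).const_mul _
  exact h.re

lemma gaussianMass_eq_ofReal (p : ℂ[X]) (S : Set ℂ) :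
    gaussianMass p S = ENNReal.ofReal
      (∫ z in S, (‖p.eval z‖ * Real.exp (-‖z‖ ^ 2)) ^ 2 ∂areaMeasure) :=
  (ofReal_integral_eq_lintegral_ofReal (integrable_sq_norm_eval_mul_exp p).integrableOn
    (.of_forall fun _ => sq_nonneg _)).symm

lemma setIntegral_sq_norm_eval {S : Set ℂ} (hS : RotationInvariant S) (hm : MeasurableSet S)
    (p : ℂ[X]) {N : ℕ} (hN : p.natDegree < N) :
    ∫ z in S, (‖p.eval z‖ * Real.exp (-‖z‖ ^ 2)) ^ 2 ∂areaMeasure =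
      ∑ k ∈ Finset.range N, ‖p.coeff k‖ ^ 2 *
        ∫ z in S, (‖(Polynomial.X ^ k : ℂ[X]).eval z‖ * Real.exp (-‖z‖ ^ 2)) ^ 2 ∂areaMeasure := by
  have hdiag : ∀ k, monomialPairing S k k = ((∫ z in S,
      (‖(Polynomial.X ^ k : ℂ[X]).eval z‖ * Real.exp (-‖z‖ ^ 2)) ^ 2 ∂areaMeasure : ℝ) : ℂ) := by
    intro k
    rw [monomialPairing, ← integral_complex_ofReal]
    congr 1
    ext z
    rw [mul_pow, Complex.ofReal_mul, Complex.ofReal_pow ‖_‖, ← Complex.mul_conj']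
    simp
  apply Complex.ofReal_injective
  rw [← integral_complex_ofReal]
  simp_rw [sq_norm_eval_mul_exp p hN]
  rw [integral_finsetSum _ fun k _ => integrable_finsetSum _ fun l _ =>
      ((integrable_monomialPairing k l).const_mul _).integrableOn, Complex.ofReal_sum]
  refine Finset.sum_congr rfl fun k hk => ?_
  rw [integral_finsetSum _ fun l _ =>
      ((integrable_monomialPairing k l).const_mul _).integrableOn]
  simp_rw [integral_const_mul]
  rw [Finset.sum_eq_single_of_mem k hk]
  · rw [Complex.ofReal_mul, ← hdiag k, Complex.mul_conj', monomialPairing]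
    push_cast
    rfl
  · intro l _ hl
    have := monomialPairing_of_ne hS hm hl.symm
    rw [monomialPairing] at this
    rw [this, mul_zero]

/-- Orthogonality of the monomials on rotation invariant sets. -/
lemma gaussianMass_eq_sum {S : Set ℂ} (hS : RotationInvariant S) (hm : MeasurableSet S)
    (p : ℂ[X]) {N : ℕ} (hN : p.natDegree < N) :
    gaussianMass p S =
      ∑ k ∈ Finset.range N, ENNReal.ofReal (‖p.coeff k‖ ^ 2) *
        gaussianMass (Polynomial.X ^ k) S := by
  rw [gaussianMass_eq_ofReal, setIntegral_sq_norm_eval hS hm p hN, ENNReal.ofReal_sum_of_nonneg]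
  · refine Finset.sum_congr rfl fun k _ => ?_
    rw [ENNReal.ofReal_mul (sq_nonneg _), gaussianMass_eq_ofReal]
  · intro k _
    exact mul_nonneg (sq_nonneg _) (integral_nonneg fun _ => sq_nonneg _)

lemma gaussianMass_mono_coeff {S : Set ℂ} (hS : RotationInvariant S) (hm : MeasurableSet S)
    {p g : ℂ[X]} (h : ∀ k, ‖g.coeff k‖ ≤ ‖p.coeff k‖) : gaussianMass g S ≤ gaussianMass p S := by
  set N := max p.natDegree g.natDegree + 1
  rw [gaussianMass_eq_sum hS hm p (N := N) (by omega),
    gaussianMass_eq_sum hS hm g (N := N) (by omega)]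
  gcongr with k _
  exact h k

/-! ### Decay of high-degree mass on a smaller disk -/

lemma le_map_smul_areaMeasure {c : ℝ} (hc : 0 < c) (hc1 : c ≤ 1) :
    areaMeasure ≤ areaMeasure.map (fun z : ℂ => c • z) := by
  have h : areaMeasure.map (fun z : ℂ => c • z) =
      ENNReal.ofReal |(c ^ Module.finrank ℝ ℂ)⁻¹| • areaMeasure := by
    rw [areaMeasure, Measure.map_smul, Measure.map_addHaar_smul _ hc.ne', smul_comm]
  rw [h]
  intro s
  rw [Measure.smul_apply, smul_eq_mul]
  refine le_mul_of_one_le_left' ?_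
  rw [ENNReal.one_le_ofReal, abs_of_pos (by positivity)]
  exact (one_le_inv₀ (by positivity)).2 (pow_le_one₀ hc.le hc1)

/-- Substitute z ↦ cz, discarding the Jacobian c² ≤ 1. The integrand gains c^{2k} e^{2(1-c²)|z|²},
and 2|z|² ≤ 2R² ≤ k bounds the exponential by e^{(1-c²)k}. -/
lemma gaussianMass_X_pow_ball_le {c R : ℝ} (hc : 0 < c) (hc1 : c ≤ 1) {k : ℕ}
    (hk : 2 * R ^ 2 ≤ k) :
    gaussianMass (Polynomial.X ^ k) (Metric.ball 0 (c * R)) ≤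
      ENNReal.ofReal ((c ^ 2 * Real.exp (1 - c ^ 2)) ^ k) *
        gaussianMass (Polynomial.X ^ k) (Metric.ball 0 R) := by
  have hc2 : c ^ 2 ≤ 1 := pow_le_one₀ hc.le hc1
  unfold gaussianMass
  rw [← lintegral_indicator Metric.isOpen_ball.measurableSet,
    ← lintegral_indicator Metric.isOpen_ball.measurableSet, ← lintegral_const_mul']
  swap
  · exact ENNReal.ofReal_ne_top
  refine (lintegral_mono' (le_map_smul_areaMeasure hc hc1) le_rfl).trans ?_
  rw [lintegral_map]
  rotate_left
  · exact Measurable.indicator (by fun_prop) Metric.isOpen_ball.measurableSet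
  · fun_prop
  refine lintegral_mono fun z => ?_
  by_cases hz : z ∈ Metric.ball (0 : ℂ) R
  · have hz' : ‖z‖ < R := by simpa using hz
    rw [Set.indicator_of_mem hz]
    refine (Set.indicator_le_self' (fun _ _ => zero_le) _).trans ?_
    rw [← ENNReal.ofReal_mul (by positivity)]
    apply ENNReal.ofReal_le_ofReal
    have hexp : Real.exp (-‖c • z‖ ^ 2) ^ 2 ≤
        Real.exp (1 - c ^ 2) ^ k * Real.exp (-‖z‖ ^ 2) ^ 2 := by
      rw [← Real.exp_nat_mul, ← Real.exp_nat_mul, ← Real.exp_nat_mul, ← Real.exp_add,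
        Real.exp_le_exp, norm_smul, Real.norm_of_nonneg hc.le]
      have h1 : ‖z‖ ^ 2 ≤ R ^ 2 := pow_le_pow_left₀ (norm_nonneg _) hz'.le 2
      push_cast
      nlinarith
    calc (‖(Polynomial.X ^ k : ℂ[X]).eval (c • z)‖ * Real.exp (-‖c • z‖ ^ 2)) ^ 2
        = (c ^ 2) ^ k * ‖z‖ ^ (2 * k) * Real.exp (-‖c • z‖ ^ 2) ^ 2 := by
          rw [Polynomial.eval_pow, Polynomial.eval_X, norm_pow, norm_smul,
            Real.norm_of_nonneg hc.le]
          ring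
      _ ≤ (c ^ 2) ^ k * ‖z‖ ^ (2 * k) *
          (Real.exp (1 - c ^ 2) ^ k * Real.exp (-‖z‖ ^ 2) ^ 2) := by gcongr
      _ = _ := by
          rw [Polynomial.eval_pow, Polynomial.eval_X, norm_pow]
          ring
  · have hz2 : c • z ∉ Metric.ball (0 : ℂ) (c * R) := by
      simpa [abs_of_pos hc, hc] using hz
    rw [Set.indicator_of_notMem hz2]
    exact zero_le

lemma gaussianMass_ball_le {c R : ℝ} (hc : 0 < c) (hc1 : c ≤ 1) {h : ℂ[X]} {n : ℕ}
    (hn : 2 * R ^ 2 ≤ n) (hh : ∀ k < n, h.coeff k = 0) :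
    gaussianMass h (Metric.ball 0 (c * R)) ≤
      ENNReal.ofReal ((c ^ 2 * Real.exp (1 - c ^ 2)) ^ n) * gaussianMass h (Metric.ball 0 R) := by
  -- This is 1 + x ≤ e^x at x = c² - 1; it makes k = n the worst degree.
  have hq1 : c ^ 2 * Real.exp (1 - c ^ 2) ≤ 1 := by
    have := Real.add_one_le_exp (-(1 - c ^ 2))
    rw [Real.exp_neg, ← one_div, le_div_iff₀ (Real.exp_pos _)] at this
    linarith
  rw [gaussianMass_eq_sum (rotationInvariant_ball _) Metric.isOpen_ball.measurableSet h
      (Nat.lt_succ_self _),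
    gaussianMass_eq_sum (rotationInvariant_ball _) Metric.isOpen_ball.measurableSet h
      (Nat.lt_succ_self _), Finset.mul_sum]
  refine Finset.sum_le_sum fun k _ => ?_
  rcases lt_or_ge k n with hk | hk
  · simp [hh k hk]
  · rw [mul_left_comm]
    gcongr
    refine (gaussianMass_X_pow_ball_le hc hc1 (hn.trans (by exact_mod_cast hk))).trans ?_
    gcongr ?_ * _
    exact ENNReal.ofReal_le_ofReal (pow_le_pow_of_le_one (by positivity) hq1 hk)

/-! ### Weighted quadratic inequalities and areas -/

/-- The weight `t` splits the cross term so that the coefficient of a² can be brought arbitrarily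
close to 1. -/
lemma sq_le_of_abs_sub_le {a b w t : ℝ} (ht : 0 < t) (h : |b - a| ≤ w) :
    b ^ 2 ≤ (1 + t) * a ^ 2 + (1 + t⁻¹) * w ^ 2 := by
  have h1 : (b - a) ^ 2 ≤ w ^ 2 := sq_le_sq' (by linarith [neg_abs_le (b - a)])
    ((le_abs_self _).trans h)
  have h2 : 2 * a * (b - a) ≤ t * a ^ 2 + t⁻¹ * (b - a) ^ 2 := by
    have : 0 ≤ t⁻¹ * (t * a - (b - a)) ^ 2 := by positivity
    have h3 : t⁻¹ * (t * a - (b - a)) ^ 2 = t * a ^ 2 + t⁻¹ * (b - a) ^ 2 - 2 * a * (b - a) := by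
      field_simp
      ring
    linarith
  have h4 : t⁻¹ * (b - a) ^ 2 ≤ t⁻¹ * w ^ 2 := by gcongr
  nlinarith

lemma setLIntegral_le_of_sq_le {S : Set ℂ} {t : ℝ} (ht : 0 < t) {x y w : ℂ → ℝ}
    (hx : Measurable x) (hS : MeasurableSet S) (h : ∀ z ∈ S, |y z - x z| ≤ w z) :
    ∫⁻ z in S, ENNReal.ofReal (y z ^ 2) ∂areaMeasure ≤
      ENNReal.ofReal (1 + t) * ∫⁻ z in S, ENNReal.ofReal (x z ^ 2) ∂areaMeasure +
      ENNReal.ofReal (1 + t⁻¹) * ∫⁻ z in S, ENNReal.ofReal (w z ^ 2) ∂areaMeasure := by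
  rw [← lintegral_const_mul' _ _ ENNReal.ofReal_ne_top,
    ← lintegral_const_mul' _ _ ENNReal.ofReal_ne_top, ← lintegral_add_left (by fun_prop)]
  refine setLIntegral_mono' hS fun z hz => ?_
  rw [← ENNReal.ofReal_mul (by positivity), ← ENNReal.ofReal_mul (by positivity),
    ← ENNReal.ofReal_add (by positivity) (by positivity)]
  exact ENNReal.ofReal_le_ofReal (sq_le_of_abs_sub_le ht (h z hz))

lemma areaMeasure_ball {r : ℝ} (hr : 0 ≤ r) :
    areaMeasure (Metric.ball 0 r) = ENNReal.ofReal (r ^ 2) := by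
  rw [areaMeasure, Measure.smul_apply, smul_eq_mul, Complex.volume_ball, mul_left_comm,
    ← ENNReal.ofReal_pow hr, ← NNReal.coe_real_pi, ENNReal.ofReal_inv_of_pos (by simpa using Real.pi_pos),
    ENNReal.ofReal_coe_nnreal, ENNReal.inv_mul_cancel (by simp [NNReal.pi_ne_zero]) (by simp),
    mul_one]

lemma areaMeasure_ball_diff_ball {c R : ℝ} (hc : 0 < c) (hc1 : c ≤ 1) (hR : 0 < R) :
    areaMeasure (Metric.ball 0 R \ Metric.ball 0 (c * R)) =
      ENNReal.ofReal (1 - c ^ 2) * areaMeasure (Metric.ball 0 R) := by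
  have hsub : Metric.ball (0 : ℂ) (c * R) ⊆ Metric.ball 0 R :=
    Metric.ball_subset_ball (by nlinarith)
  have hc2 : c ^ 2 ≤ 1 := pow_le_one₀ hc.le hc1
  rw [measure_sdiff hsub Metric.isOpen_ball.measurableSet.nullMeasurableSet
      (by rw [areaMeasure_ball (by positivity)]; exact ENNReal.ofReal_ne_top),
    areaMeasure_ball hR.le, areaMeasure_ball (by positivity), ← ENNReal.ofReal_sub _ (by positivity),
    ← ENNReal.ofReal_mul (by linarith)]
  congr 1
  ring

lemma setLIntegral_indicator_sq_le {R : ℝ} {S : Set ℂ} :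
    ∫⁻ z in S, ENNReal.ofReal
      ((Metric.ball (0 : ℂ) R).indicator (fun _ => (1 : ℝ)) z ^ 2) ∂areaMeasure ≤
      areaMeasure (Metric.ball 0 R ∩ S) := by
  have h : ∀ z, ENNReal.ofReal ((Metric.ball (0 : ℂ) R).indicator (fun _ => (1 : ℝ)) z ^ 2) =
      (Metric.ball (0 : ℂ) R).indicator 1 z := by
    intro z
    by_cases hz : z ∈ Metric.ball (0 : ℂ) R <;> simp [hz]
  simp_rw [h]
  rw [lintegral_indicator_one Metric.isOpen_ball.measurableSet,
    Measure.restrict_apply Metric.isOpen_ball.measurableSet]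

/-! ### Truncation and its effect on the discrepancy -/

/-- The part of `p` of degree less than `n`. -/
noncomputable def truncation (p : ℂ[X]) (n : ℕ) : ℂ[X] :=
  ∑ k ∈ Finset.range n, Polynomial.monomial k (p.coeff k)

lemma coeff_truncation (p : ℂ[X]) (n k : ℕ) :
    (truncation p n).coeff k = if k < n then p.coeff k else 0 := by
  simp [truncation, Polynomial.finsetSum_coeff, Polynomial.coeff_monomial]

lemma truncation_mem_polLT (p : ℂ[X]) (n : ℕ) : truncation p n ∈ polLT n := by
  refine (Polynomial.degree_lt_iff_coeff_zero _ _).2 fun k hk => ?_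
  rw [coeff_truncation, if_neg (by omega)]

lemma measurable_ball_indicator (R : ℝ) :
    Measurable ((Metric.ball (0 : ℂ) R).indicator (fun _ => (1 : ℝ))) :=
  measurable_const.indicator Metric.isOpen_ball.measurableSet

lemma measurable_norm_eval_mul_exp (p : ℂ[X]) :
    Measurable (fun z : ℂ => ‖p.eval z‖ * Real.exp (-‖z‖ ^ 2)) := by
  fun_prop

/-- With `discrepancy_le_gaussianMass`, this exchanges mass and discrepancy at a cost governed by
the area of D(0,R) ∩ S, which is small when S avoids D(0,cR). -/
lemma gaussianMass_le_discrepancy {t : ℝ} (ht : 0 < t) {S : Set ℂ} (hS : MeasurableSet S)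
    (p : ℂ[X]) (R : ℝ) :
    gaussianMass p S ≤ ENNReal.ofReal (1 + t) *
      ∫⁻ z in S, ENNReal.ofReal (discrepancy (fun z => p.eval z) R z) ∂areaMeasure +
      ENNReal.ofReal (1 + t⁻¹) * areaMeasure (Metric.ball 0 R ∩ S) := by
  refine (setLIntegral_le_of_sq_le ht
    ((measurable_norm_eval_mul_exp p).sub (measurable_ball_indicator R)) hS
    (w := (Metric.ball (0 : ℂ) R).indicator (fun _ => (1 : ℝ))) fun z _ => ?_).trans
    (add_le_add le_rfl (mul_le_mul_right setLIntegral_indicator_sq_le _))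
  rw [Pi.sub_apply, sub_sub_cancel]
  exact (abs_of_nonneg (Set.indicator_nonneg (fun _ _ => zero_le_one) _)).le

lemma discrepancy_le_gaussianMass {t : ℝ} (ht : 0 < t) {S : Set ℂ} (hS : MeasurableSet S)
    (p : ℂ[X]) (R : ℝ) :
    ∫⁻ z in S, ENNReal.ofReal (discrepancy (fun z => p.eval z) R z) ∂areaMeasure ≤
      ENNReal.ofReal (1 + t) * gaussianMass p S +
      ENNReal.ofReal (1 + t⁻¹) * areaMeasure (Metric.ball 0 R ∩ S) := by
  refine (setLIntegral_le_of_sq_le ht (measurable_norm_eval_mul_exp p) hS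
    (w := (Metric.ball (0 : ℂ) R).indicator (fun _ => (1 : ℝ))) fun z _ => ?_).trans
    (add_le_add le_rfl (mul_le_mul_right setLIntegral_indicator_sq_le _))
  rw [sub_sub_cancel_left, abs_neg]
  exact (abs_of_nonneg (Set.indicator_nonneg (fun _ _ => zero_le_one) _)).le

lemma discrepancy_le_discrepancy_add {t : ℝ} (ht : 0 < t) {S : Set ℂ} (hS : MeasurableSet S)
    (p g : ℂ[X]) (R : ℝ) :
    ∫⁻ z in S, ENNReal.ofReal (discrepancy (fun z => g.eval z) R z) ∂areaMeasure ≤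
      ENNReal.ofReal (1 + t) *
      ∫⁻ z in S, ENNReal.ofReal (discrepancy (fun z => p.eval z) R z) ∂areaMeasure +
      ENNReal.ofReal (1 + t⁻¹) * gaussianMass (p - g) S := by
  refine setLIntegral_le_of_sq_le ht
    ((measurable_norm_eval_mul_exp p).sub (measurable_ball_indicator R)) hS fun z _ => ?_
  rw [sub_sub_sub_cancel_right, ← sub_mul, abs_mul, abs_of_pos (Real.exp_pos _),
    Polynomial.eval_sub, norm_sub_rev]
  gcongr
  exact abs_norm_sub_norm_le _ _

/-- Truncating a polynomial at degree `⌈2R²⌉` barely increases its discrepancy. -/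
lemma discrepancy_truncation_le {t c R : ℝ} (ht : 0 < t) (hc : 0 < c) (hc1 : c ≤ 1) (hR : 0 < R)
    {E : Set ℂ} (hE : RotationInvariant E) (hm : MeasurableSet E) (hRE : Metric.ball 0 R ⊆ E)
    (p : ℂ[X]) :
    ∫⁻ z in E, ENNReal.ofReal
        (discrepancy (fun z => (truncation p (degreeBound R)).eval z) R z) ∂areaMeasure ≤
      (ENNReal.ofReal (1 + t) ^ 2 + ENNReal.ofReal (1 + t⁻¹) *
          ENNReal.ofReal ((c ^ 2 * Real.exp (1 - c ^ 2)) ^ degreeBound R) * 2) *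
        ∫⁻ z in E, ENNReal.ofReal (discrepancy (fun z => p.eval z) R z) ∂areaMeasure +
      (ENNReal.ofReal (1 + t⁻¹) *
          ENNReal.ofReal ((c ^ 2 * Real.exp (1 - c ^ 2)) ^ degreeBound R) * 2 +
        (ENNReal.ofReal (1 + t) + 1) * ENNReal.ofReal (1 + t⁻¹) * ENNReal.ofReal (1 - c ^ 2)) *
          areaMeasure (Metric.ball 0 R) := by
  set n := degreeBound R
  set g := truncation p n
  set B := Metric.ball (0 : ℂ) (c * R)
  set D := Metric.ball (0 : ℂ) R
  set q := ENNReal.ofReal ((c ^ 2 * Real.exp (1 - c ^ 2)) ^ n)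
  set a := ENNReal.ofReal (1 + t)
  set b := ENNReal.ofReal (1 + t⁻¹)
  set Ψ : ℂ[X] → Set ℂ → ℝ≥0∞ := fun f S =>
    ∫⁻ z in S, ENNReal.ofReal (discrepancy (fun z => f.eval z) R z) ∂areaMeasure with hΨ
  change Ψ g E ≤ (a ^ 2 + b * q * 2) * Ψ p E +
    (b * q * 2 + (a + 1) * b * ENNReal.ofReal (1 - c ^ 2)) * areaMeasure D
  have hB : MeasurableSet B := Metric.isOpen_ball.measurableSet
  have hD : MeasurableSet D := Metric.isOpen_ball.measurableSet
  have hBE : B ⊆ E := (Metric.ball_subset_ball (by nlinarith)).trans hRE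
  have ha1 : 1 ≤ a := ENNReal.one_le_ofReal.2 (by linarith)
  have hsplit : ∀ f, Ψ f E = Ψ f B + Ψ f (E \ B) := by
    intro f
    rw [hΨ]
    dsimp only
    rw [← lintegral_inter_add_sdiff _ E hB, Set.inter_eq_right.2 hBE]
  have hann : areaMeasure (D ∩ (E \ B)) ≤ ENNReal.ofReal (1 - c ^ 2) * areaMeasure D := by
    rw [← areaMeasure_ball_diff_ball hc hc1 hR]
    exact measure_mono fun z hz => ⟨hz.1, hz.2.2⟩
  have hin : Ψ g B ≤ a * Ψ p B + b * gaussianMass (p - g) B :=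
    discrepancy_le_discrepancy_add ht hB p g R
  have hhigh : gaussianMass (p - g) B ≤ q * (2 * Ψ p E + 2 * areaMeasure D) := by
    refine (gaussianMass_ball_le hc hc1 (n := n) (Nat.le_ceil _) fun k hk => ?_).trans ?_
    · simp [g, coeff_truncation, hk]
    · gcongr
      refine (gaussianMass_mono_coeff (rotationInvariant_ball R) hD (p := p) fun k => ?_).trans ?_
      · by_cases hk : k < n <;> simp [g, coeff_truncation, hk]
      -- The crude weight 1 suffices, since the small factor `q` multiplies this bound.
      · refine (gaussianMass_le_discrepancy one_pos hD p R).trans ?_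
        rw [inv_one, one_add_one_eq_two, ENNReal.ofReal_ofNat]
        gcongr
        · exact lintegral_mono_set hRE
        · exact Set.inter_subset_left
  -- Passing from discrepancy to mass and back costs one factor `a` each way, hence `a ^ 2`.
  have hout : Ψ g (E \ B) ≤ a ^ 2 * Ψ p (E \ B) +
      (a + 1) * b * (ENNReal.ofReal (1 - c ^ 2) * areaMeasure D) := by
    have hEB : MeasurableSet (E \ B) := hm.diff hB
    calc Ψ g (E \ B) ≤ a * gaussianMass g (E \ B) + b * areaMeasure (D ∩ (E \ B)) :=
          discrepancy_le_gaussianMass ht hEB g R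
      _ ≤ a * gaussianMass p (E \ B) + b * areaMeasure (D ∩ (E \ B)) := by
          gcongr
          refine gaussianMass_mono_coeff (hE.diff (rotationInvariant_ball _)) hEB fun k => ?_
          by_cases hk : k < n <;> simp [g, coeff_truncation, hk]
      _ ≤ a * (a * Ψ p (E \ B) + b * areaMeasure (D ∩ (E \ B))) +
          b * areaMeasure (D ∩ (E \ B)) := by
          gcongr
          exact gaussianMass_le_discrepancy ht hEB p R
      _ = a ^ 2 * Ψ p (E \ B) + (a + 1) * b * areaMeasure (D ∩ (E \ B)) := by ring
      _ ≤ _ := by gcongr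
  calc Ψ g E = Ψ g B + Ψ g (E \ B) := hsplit g
    _ ≤ (a * Ψ p B + b * (q * (2 * Ψ p E + 2 * areaMeasure D))) + (a ^ 2 * Ψ p (E \ B) +
      (a + 1) * b * (ENNReal.ofReal (1 - c ^ 2) * areaMeasure D)) := by
        gcongr
        exact hin.trans (by gcongr)
    _ ≤ (a ^ 2 * Ψ p B + b * (q * (2 * Ψ p E + 2 * areaMeasure D))) + (a ^ 2 * Ψ p (E \ B) +
      (a + 1) * b * (ENNReal.ofReal (1 - c ^ 2) * areaMeasure D)) := by
        gcongr
        exact le_self_pow ha1 two_ne_zero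
    _ = _ := by
        rw [hsplit p]
        ring

/-! ### Infima and the lower limit -/

/-- The discrepancy of `f` over `E`, normalized by the area of the disk of radius `R`. -/
noncomputable def meanDiscrepancyOn (E : Set ℂ) (f : ℂ → ℂ) (R : ℝ) : ℝ≥0∞ :=
  (∫⁻ z in E, ENNReal.ofReal (discrepancy f R z) ∂areaMeasure) / areaMeasure (Metric.ball 0 R)

lemma meanDiscrepancy_eq (f : ℂ → ℂ) (R : ℝ) :
    meanDiscrepancy f R = meanDiscrepancyOn (Metric.ball 0 R) f R := by
  rw [meanDiscrepancy, meanDiscrepancyOn, setLIntegral_one]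

lemma tightMeanDiscrepancy_eq (f : ℂ → ℂ) (R : ℝ) :
    tightMeanDiscrepancy f R = meanDiscrepancyOn Set.univ f R := by
  rw [tightMeanDiscrepancy, meanDiscrepancyOn, setLIntegral_one, setLIntegral_univ]

lemma meanDiscrepancyOn_zero_le (E : Set ℂ) (R : ℝ) :
    meanDiscrepancyOn E (fun z => (0 : ℂ[X]).eval z) R ≤ 1 := by
  refine ENNReal.div_le_of_le_mul ?_
  rw [one_mul]
  simp only [discrepancy, Polynomial.eval_zero, norm_zero, zero_mul, zero_sub, neg_sq]
  exact setLIntegral_indicator_sq_le.trans (measure_mono Set.inter_subset_left)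

lemma iInf_polLT_le {t c R : ℝ} (ht : 0 < t) (hc : 0 < c) (hc1 : c ≤ 1) (hR : 0 < R)
    {E : Set ℂ} (hE : RotationInvariant E) (hm : MeasurableSet E) (hRE : Metric.ball 0 R ⊆ E) :
    ⨅ p ∈ polLT (degreeBound R), meanDiscrepancyOn E (fun z => p.eval z) R ≤
      (⨅ p : ℂ[X], meanDiscrepancyOn E (fun z => p.eval z) R) +
        ENNReal.ofReal (((1 + t) ^ 2 - 1) + ((1 + t) + 1) * (1 + t⁻¹) * (1 - c ^ 2) +
          4 * (1 + t⁻¹) * (c ^ 2 * Real.exp (1 - c ^ 2)) ^ degreeBound R) := by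
  set n := degreeBound R
  set Q := (c ^ 2 * Real.exp (1 - c ^ 2)) ^ n
  set I := ⨅ p : ℂ[X], meanDiscrepancyOn E (fun z => p.eval z) R
  have hc2 : c ^ 2 ≤ 1 := pow_le_one₀ hc.le hc1
  have hQ : 0 ≤ Q := by positivity
  -- Testing with the zero polynomial bounds the infimum, so the multiplicative error `α` becomes
  -- additive.
  have hI : I ≤ 1 := (iInf_le _ 0).trans (meanDiscrepancyOn_zero_le E R)
  have hA0 : areaMeasure (Metric.ball 0 R) ≠ 0 := by
    rw [areaMeasure_ball hR.le]
    simpa using hR.ne'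
  have hAt : areaMeasure (Metric.ball 0 R) ≠ ∞ := by
    rw [areaMeasure_ball hR.le]
    exact ENNReal.ofReal_ne_top
  set α : ℝ := (1 + t) ^ 2 - 1 + (1 + t⁻¹) * Q * 2 with hα
  have hα0 : 0 ≤ α := by
    have : 0 ≤ (1 + t⁻¹) * Q * 2 := by positivity
    nlinarith
  set β : ℝ := (1 + t⁻¹) * Q * 2 + ((1 + t) + 1) * (1 + t⁻¹) * (1 - c ^ 2) with hβ
  have hβ0 : 0 ≤ β := by
    have : 0 ≤ 1 - c ^ 2 := by linarith
    positivity
  have hstep : ∀ p : ℂ[X], meanDiscrepancyOn E (fun z => (truncation p n).eval z) R ≤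
      ENNReal.ofReal (1 + α) * meanDiscrepancyOn E (fun z => p.eval z) R + ENNReal.ofReal β := by
    intro p
    refine ENNReal.div_le_of_le_mul
      ((discrepancy_truncation_le ht hc hc1 hR hE hm hRE p).trans_eq ?_)
    rw [meanDiscrepancyOn, add_mul (ENNReal.ofReal (1 + α) * _), mul_assoc (ENNReal.ofReal (1 + α)),
      ENNReal.div_mul_cancel hA0 hAt]
    have h2 : (2 : ℝ≥0∞) = ENNReal.ofReal 2 := by simp
    have h3 : (1 - c ^ 2 : ℝ) ≥ 0 := by linarith
    congr 2
    · rw [h2, ← ENNReal.ofReal_pow (by positivity), ← ENNReal.ofReal_mul (by positivity),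
        ← ENNReal.ofReal_mul (by positivity), ← ENNReal.ofReal_add (by positivity) (by positivity)]
      congr 1
      rw [hα]
      ring
    · rw [h2, ← ENNReal.ofReal_mul (by positivity), ← ENNReal.ofReal_mul (by positivity),
        ← ENNReal.ofReal_one, ← ENNReal.ofReal_add (by positivity) (by positivity),
        ← ENNReal.ofReal_mul (by positivity), ← ENNReal.ofReal_mul (by positivity),
        ← ENNReal.ofReal_add (by positivity) (by positivity)]
  have hJ : ⨅ p ∈ polLT n, meanDiscrepancyOn E (fun z => p.eval z) R ≤
      ENNReal.ofReal (1 + α) * I + ENNReal.ofReal β := by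
    rw [ENNReal.mul_iInf_of_ne (by simpa using by linarith) ENNReal.ofReal_ne_top,
      ENNReal.iInf_add]
    exact le_iInf fun p => (iInf₂_le (truncation p n) (truncation_mem_polLT p n)).trans (hstep p)
  refine hJ.trans ?_
  rw [ENNReal.ofReal_add zero_le_one hα0, ENNReal.ofReal_one, add_mul, one_mul, add_assoc]
  gcongr
  calc ENNReal.ofReal α * I + ENNReal.ofReal β ≤ ENNReal.ofReal α * 1 + ENNReal.ofReal β := by
        gcongr
    _ = ENNReal.ofReal (α + β) := by rw [mul_one, ENNReal.ofReal_add hα0 hβ0]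
    _ ≤ _ := by
        apply ENNReal.ofReal_le_ofReal
        rw [hα, hβ]
        linarith

lemma tendsto_degreeBound : Tendsto degreeBound atTop atTop := by
  refine tendsto_nat_ceil_atTop.comp ?_
  exact (tendsto_pow_atTop two_ne_zero).const_mul_atTop two_pos

/-- The error in `iInf_polLT_le` can be made arbitrarily small. -/
lemma exists_error_lt {ε : ℝ} (hε : 0 < ε) : ∃ t c : ℝ, 0 < t ∧ 0 < c ∧ c ≤ 1 ∧
    ∀ᶠ R in atTop, ((1 + t) ^ 2 - 1) + ((1 + t) + 1) * (1 + t⁻¹) * (1 - c ^ 2) +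
          4 * (1 + t⁻¹) * (c ^ 2 * Real.exp (1 - c ^ 2)) ^ degreeBound R < ε := by
  -- `t` must precede `c`: the factor 1 + t⁻¹ is large and is compensated by 1 - c², then by the
  -- power as R grows.
  obtain ⟨t, ht1, ht⟩ : ∃ t : ℝ, (1 + t) ^ 2 - 1 < ε ∧ 0 < t := by
    have h : Tendsto (fun t : ℝ => (1 + t) ^ 2 - 1) (nhdsWithin 0 (Set.Ioi 0)) (nhds 0) := by
      refine Tendsto.mono_left ?_ nhdsWithin_le_nhds
      have : ContinuousAt (fun t : ℝ => (1 + t) ^ 2 - 1) 0 := by fun_prop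
      simpa [ContinuousAt] using this
    exact ((h.eventually_lt_const hε).and self_mem_nhdsWithin).exists
  obtain ⟨c, hc, hc0, hc1⟩ : ∃ c : ℝ,
      (1 + t) ^ 2 - 1 + ((1 + t) + 1) * (1 + t⁻¹) * (1 - c ^ 2) < ε ∧ 0 < c ∧ c < 1 := by
    have h : Tendsto (fun c : ℝ => (1 + t) ^ 2 - 1 + ((1 + t) + 1) * (1 + t⁻¹) * (1 - c ^ 2))
        (nhdsWithin 1 (Set.Iio 1)) (nhds ((1 + t) ^ 2 - 1)) := by
      refine Tendsto.mono_left ?_ nhdsWithin_le_nhds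
      have : ContinuousAt
        (fun c : ℝ => (1 + t) ^ 2 - 1 + ((1 + t) + 1) * (1 + t⁻¹) * (1 - c ^ 2)) 1 := by fun_prop
      simpa [ContinuousAt] using this
    exact ((h.eventually_lt_const ht1).and (Ioo_mem_nhdsLT zero_lt_one)).exists
  refine ⟨t, c, ht, hc0, hc1.le, ?_⟩
  have hc2 : c ^ 2 < 1 := pow_lt_one₀ hc0.le hc1 two_ne_zero
  have hq : c ^ 2 * Real.exp (1 - c ^ 2) < 1 := by
    have := Real.add_one_lt_exp (x := -(1 - c ^ 2)) (by linarith)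
    rw [Real.exp_neg, ← one_div, lt_div_iff₀ (Real.exp_pos _)] at this
    linarith
  have h := (((tendsto_pow_atTop_nhds_zero_of_lt_one (by positivity) hq).comp
    tendsto_degreeBound).const_mul (4 * (1 + t⁻¹))).const_add
      ((1 + t) ^ 2 - 1 + ((1 + t) + 1) * (1 + t⁻¹) * (1 - c ^ 2))
  rw [mul_zero, add_zero] at h
  exact h.eventually_lt_const hc

/-- The general family `E` covers both densities, with E R = D(0,R) and E R = ℂ. One inequality is
just the smaller range of the infimum. -/
lemma liminf_iInf_polLT {E : ℝ → Set ℂ} (hE : ∀ R, RotationInvariant (E R))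
    (hm : ∀ R, MeasurableSet (E R)) (hRE : ∀ R, Metric.ball 0 R ⊆ E R) :
    liminf (fun R : ℝ => ⨅ p ∈ polLT (degreeBound R),
        meanDiscrepancyOn (E R) (fun z => p.eval z) R) atTop =
      liminf (fun R : ℝ => ⨅ p : ℂ[X], meanDiscrepancyOn (E R) (fun z => p.eval z) R) atTop := by
  apply le_antisymm
  · refine ENNReal.le_of_forall_pos_le_add fun ε hε _ => ?_
    obtain ⟨t, c, ht, hc, hc1, h⟩ := exists_error_lt (NNReal.coe_pos.2 hε)
    refine (liminf_le_liminf (v := fun R : ℝ =>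
      (⨅ p : ℂ[X], meanDiscrepancyOn (E R) (fun z => p.eval z) R) + ε) ?_).trans_eq ?_
    · filter_upwards [h, eventually_gt_atTop 0] with R hR hR0
      refine (iInf_polLT_le ht hc hc1 hR0 (hE R) (hm R) (hRE R)).trans ?_
      gcongr
      exact ENNReal.ofReal_le_of_le_toReal hR.le
    · exact liminf_add_const atTop _ _ (by isBoundedDefault) (by isBoundedDefault)
  · exact liminf_le_liminf (.of_forall fun R => le_iInf₂ fun p _ => iInf_le _ p)

end PlanarDiscrepancy

theorem corollary1p5 :
    liminf (fun R : ℝ =>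
        ⨅ p ∈ PlanarDiscrepancy.polLT (PlanarDiscrepancy.degreeBound R),
          PlanarDiscrepancy.meanDiscrepancy (fun z => Polynomial.eval z p) R) atTop
      = PlanarDiscrepancy.planarDensity ∧
    liminf (fun R : ℝ =>
        ⨅ p ∈ PlanarDiscrepancy.polLT (PlanarDiscrepancy.degreeBound R),
          PlanarDiscrepancy.tightMeanDiscrepancy (fun z => Polynomial.eval z p) R) atTop
      = PlanarDiscrepancy.tightPlanarDensity := by
  unfold PlanarDiscrepancy.planarDensity PlanarDiscrepancy.tightPlanarDensity
  simp_rw [PlanarDiscrepancy.meanDiscrepancy_eq, PlanarDiscrepancy.tightMeanDiscrepancy_eq]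
  exact ⟨PlanarDiscrepancy.liminf_iInf_polLT PlanarDiscrepancy.rotationInvariant_ball
      (fun _ => Metric.isOpen_ball.measurableSet) fun _ => subset_rfl,
    PlanarDiscrepancy.liminf_iInf_polLT (fun _ => PlanarDiscrepancy.rotationInvariant_univ)
      (fun _ => MeasurableSet.univ) fun _ => Set.subset_univ _⟩
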